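/- For integers $N$ and $d$ let $\mathcal{F}^{\mathbb{R}}_{N,d}$ denote the space of real finite unit norm tight frames of $N$ vectors in $\mathbb{R}^d$, i.e. the set of all $N$-tuples $(f_1,\dots,f_N)$ of vectors in $\mathbb{R}^d$ (with the standard inner product) such that $\|f_n\|=1$ for every $n$ and there is a constant $A>0$ with $$\sum_{n=1}^N |\langle x,f_n\rangle|^2 = A\,\|x\|^2\qquad\text{for all } x\in\mathbb{R}^d,$$ equipped with the subspace topology from $(\mathbb{R}^d)^N$. If $N\ge d+2\ge 4$, then $\mathcal{F}^{\mathbb{R}}_{N,d}$ is path-connected. -/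

import Mathlib

/-- A finite family `f` in a real inner product space is a tight frame if the frame inequalities
`A * ‖x‖ ^ 2 ≤ ∑ n, |⟪x, f n⟫| ^ 2 ≤ B * ‖x‖ ^ 2` hold with equal positive constants `A = B`. -/
def IsTightFrame {ι : Type*} [Fintype ι] {E : Type*} [NormedAddCommGroup E]
    [InnerProductSpace ℝ E] (f : ι → E) : Prop :=
  ∃ A : ℝ, 0 < A ∧ ∀ x : E, ∑ n, |inner ℝ x (f n)| ^ 2 = A * ‖x‖ ^ 2

/-- The space of real finite unit norm tight frames (FUNTFs) of `N` vectors in `ℝ^d`, as a subset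
of the space of `N`-tuples of vectors in `ℝ^d` (equivalently, of `d × N` real matrices, listed by
columns) with its usual topology. -/
def realFUNTF (N d : ℕ) : Set (Fin N → EuclideanSpace ℝ (Fin d)) :=
  {f | (∀ n, ‖f n‖ = 1) ∧ IsTightFrame f}

/-!
Put `N = d + e`. The rows of a tight frame are, up to scaling, `d` orthonormal vectors in `ℝ^N`;
completing them to an orthonormal basis gives an orthogonal matrix `Q`, and the unit norm condition
says that every column of `Q` is isotropic for the traceless quadratic form `B = P - d / N`, where
`P` is the projection to the first `d` coordinates. So the space of frames is the image of the space
of isotropic orthonormal bases of `B` (`toFrame_mem`, `exists_toFrame_eq`); since `e > 0`, bases of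
one orientation suffice, because a row outside of the first `d` may be negated. It remains to join
any two isotropic bases of the same orientation.

Two moves are used. If two basis vectors are orthogonal for `B`, they can be rotated freely in
their plane. If three basis vectors are pairwise non-orthogonal for `B`, then in their span one can
move along the cone of isotropic vectors, which is a rational curve, and carry along the two
remaining basis vectors (`exists_isotropic_path_of_mul_neg`).

Given isotropic bases `Q` and `Q₁`, expand a vector `u` of `Q₁` in the basis `Q` with coordinates
`a i`, and let `M` be the matrix of `B` in the basis `Q`. If `M i j = 0` for two indices in the
support of `a`, a rotation kills a coordinate. Otherwise, isotropy `∑ a i * M i j * a j = 0` forces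
two terms with a common index to have opposite signs, and a move of the corresponding three vectors
kills a coordinate (`exists_joinedIn_card_lt`). In this way `u` becomes, up to sign, a vector of the
basis, and one continues with the remaining vectors. Hence any two isotropic bases can be
joined up to signed permutations of the basis vectors.

Signed permutations preserving the orientation are products of quarter turns of two basis vectors,
and such a quarter turn is realised by a path if the two vectors are orthogonal for `B`. It is enough
that one pair is orthogonal: rotating this pair makes one of its members orthogonal to any third
vector (`joinedIn_quarterTurn_of_gram_eq_zero`). A basis with an orthogonal pair exists when `d ≥ 2`
and `e ≥ 2` (`exists_isotropicBases_gram_eq_zero`), which is where the hypotheses enter.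
-/

set_option linter.unusedSectionVars false

open Matrix

/-! ### Isotropic bases in dimension three -/

theorem mul_mul_transpose_apply {m n : Type*} [Fintype n] (A : Matrix m n ℝ) (M : Matrix n n ℝ)
    (i j : m) : (A * M * Aᵀ) i j = A i ⬝ᵥ M *ᵥ A j := by
  rw [dotProduct_mulVec]; rfl

/-- A path of isotropic unit vectors `u t` for a nondegenerate traceless form `M` on `ℝ³` extends to a
path of isotropic orthonormal bases `K t`. The restriction of `M` to the plane `(u t)ᗮ` is traceless
and never zero, so it has exactly two isotropic lines in that plane, and following them amounts to
a continuous choice of a square root of a nonvanishing complex function of `t`. -/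
theorem exists_continuous_isotropic_frame {M : Matrix (Fin 3) (Fin 3) ℝ} (hM : Mᵀ = M)
    (hdiag : ∀ p, M p p = 0) (hinj : ∀ v, M *ᵥ v = 0 → v = 0) {u : ℝ → Fin 3 → ℝ}
    (hu : Continuous u) (hu1 : ∀ t, u t ⬝ᵥ u t = 1) (hu0 : ∀ t, u t ⬝ᵥ M *ᵥ u t = 0)
    {t₀ : ℝ} (ht₀ : u t₀ = ![1, 0, 0]) :
    ∃ K : ℝ → Matrix (Fin 3) (Fin 3) ℝ, Continuous K ∧ (∀ t, (K t)ᵀ * K t = 1) ∧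
      (∀ t p, ((K t)ᵀ * M * K t) p p = 0) ∧ (∀ t p, K t p 0 = u t p) ∧ K t₀ = 1 := by
  have hsymm : ∀ v w : Fin 3 → ℝ, v ⬝ᵥ M *ᵥ w = w ⬝ᵥ M *ᵥ v := fun v w ↦ by
    rw [dotProduct_mulVec, ← mulVec_transpose, hM, dotProduct_comm]
  have hpos : ∀ t, 0 < (M *ᵥ u t) ⬝ᵥ (M *ᵥ u t) := fun t ↦ by
    refine lt_of_le_of_ne (by simpa using dotProduct_self_star_nonneg (M *ᵥ u t)) fun h ↦ ?_
    have h0 := hinj _ (dotProduct_self_eq_zero.1 h.symm)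
    have := hu1 t
    simp [h0] at this
  set r : ℝ → ℝ := fun t ↦ √((M *ᵥ u t) ⬝ᵥ (M *ᵥ u t)) with hr
  have hr0 : ∀ t, 0 < r t := fun t ↦ Real.sqrt_pos.2 (hpos t)
  have hr2 : ∀ t, r t * r t = (M *ᵥ u t) ⬝ᵥ (M *ᵥ u t) := fun t ↦ Real.mul_self_sqrt (hpos t).le
  set e : ℝ → Fin 3 → ℝ := fun t ↦ (r t)⁻¹ • M *ᵥ u t with he
  have hMu : ∀ t, M *ᵥ u t = r t • e t := fun t ↦ by simp [he, smul_smul, (hr0 t).ne']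
  set f : ℝ → Fin 3 → ℝ := fun t ↦ crossProduct (u t) (e t) with hf
  have hvc : Continuous fun t ↦ M *ᵥ u t := continuous_const.matrix_mulVec hu
  have hrc : Continuous r := (hvc.dotProduct hvc).sqrt
  have hec : Continuous e := (hrc.inv₀ fun t ↦ (hr0 t).ne').smul hvc
  have hfc : Continuous f := by
    have h1 : ∀ i, Continuous fun t ↦ u t i := fun i ↦ (continuous_apply i).comp hu
    have h2 : ∀ i, Continuous fun t ↦ e t i := fun i ↦ (continuous_apply i).comp hec
    simp only [hf, cross_apply]
    refine continuous_pi fun i ↦ ?_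
    fin_cases i <;> simp <;> fun_prop
  have hue : ∀ t, u t ⬝ᵥ e t = 0 := fun t ↦ by simp [he, hu0 t]
  have hee : ∀ t, e t ⬝ᵥ e t = 1 := fun t ↦ by
    have := (hr0 t).ne'
    simp only [he, smul_dotProduct, dotProduct_smul, smul_eq_mul, ← hr2 t]
    field_simp
  have hff : ∀ t, f t ⬝ᵥ f t = 1 := fun t ↦ by
    simp only [hf]
    rw [cross_dot_cross, hu1, hee, dotProduct_comm (e t), hue]; norm_num
  have huf : ∀ t, u t ⬝ᵥ f t = 0 := fun t ↦ dot_self_cross _ _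
  have hef : ∀ t, e t ⬝ᵥ f t = 0 := fun t ↦ dot_cross_self _ _
  have hfe : ∀ t, f t ⬝ᵥ e t = 0 := fun t ↦ by rw [dotProduct_comm, hef]
  have hfu : ∀ t, f t ⬝ᵥ u t = 0 := fun t ↦ by rw [dotProduct_comm, huf]
  have heu : ∀ t, e t ⬝ᵥ u t = 0 := fun t ↦ by rw [dotProduct_comm, hue]
  -- `F t` is the orthogonal matrix with rows `u t, e t, f t`.
  set F : ℝ → Matrix (Fin 3) (Fin 3) ℝ := fun t ↦ Matrix.of ![u t, e t, f t] with hF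
  have hFF : ∀ t, F t * (F t)ᵀ = 1 := fun t ↦ by
    ext i j
    change F t i ⬝ᵥ F t j = _
    fin_cases i <;> fin_cases j
    exacts [hu1 t, hue t, huf t, heu t, hee t, hef t, hfu t, hfe t, hff t]
  have hFF' : ∀ t, (F t)ᵀ * F t = 1 := fun t ↦ mul_eq_one_comm.1 (hFF t)
  set α : ℝ → ℝ := fun t ↦ e t ⬝ᵥ M *ᵥ e t with hα
  set γ : ℝ → ℝ := fun t ↦ e t ⬝ᵥ M *ᵥ f t with hγ
  have hαc : Continuous α := hec.dotProduct (continuous_const.matrix_mulVec hec)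
  have hγc : Continuous γ := hec.dotProduct (continuous_const.matrix_mulVec hfc)
  have hfMe : ∀ t, f t ⬝ᵥ M *ᵥ e t = γ t := fun t ↦ hsymm _ _
  have htr : ∀ t, f t ⬝ᵥ M *ᵥ f t = - α t := fun t ↦ by
    have h1 : (F t * M * (F t)ᵀ).trace = 0 := by
      rw [trace_mul_cycle, hFF', one_mul]
      simp [trace, hdiag]
    have h2 : ∀ i, (F t * M * (F t)ᵀ) i i = F t i ⬝ᵥ M *ᵥ F t i := fun i ↦ by
      rw [mul_mul_transpose_apply]
    simp only [trace, diag_apply, h2, Fin.sum_univ_three] at h1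
    have h3 : u t ⬝ᵥ M *ᵥ u t + e t ⬝ᵥ M *ᵥ e t + f t ⬝ᵥ M *ᵥ f t = 0 := h1
    rw [hu0] at h3
    simp only [hα]
    linarith
  have hne : ∀ t, (⟨γ t, α t⟩ : ℂ) ≠ 0 := fun t h ↦ by
    have hγ0 : γ t = 0 := congrArg Complex.re h
    have hα0 : α t = 0 := congrArg Complex.im h
    have h1 : u t ⬝ᵥ M *ᵥ f t = 0 := by rw [hsymm, hMu, dotProduct_smul, hfe, smul_zero]
    have h2 : F t *ᵥ (M *ᵥ f t) = 0 := by
      ext i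
      change F t i ⬝ᵥ _ = 0
      fin_cases i
      · exact h1
      · exact hγ0
      · exact (htr t).trans (by rw [hα0, neg_zero])
    have h3 : M *ᵥ f t = 0 := by
      rw [← one_mulVec (M *ᵥ f t), ← hFF' t, ← mulVec_mulVec, h2, mulVec_zero]
    have := hff t
    simp [hinj _ h3] at this
  have hquad : ∀ t (c s : ℝ), (c • e t + s • f t) ⬝ᵥ M *ᵥ (c • e t + s • f t) =
      α t * (c ^ 2 - s ^ 2) + 2 * γ t * (c * s) := fun t c s ↦ by
    simp only [mulVec_add, mulVec_smul, add_dotProduct, dotProduct_add, smul_dotProduct,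
      dotProduct_smul, smul_eq_mul, htr, hfMe]
    simp only [hα, hγ]
    ring
  have hnorm : ∀ t (c s : ℝ), (c • e t + s • f t) ⬝ᵥ (c • e t + s • f t) = c ^ 2 + s ^ 2 :=
    fun t c s ↦ by
    simp only [add_dotProduct, dotProduct_add, smul_dotProduct,
      dotProduct_smul, smul_eq_mul, hee, hff, hef, hfe]
    ring
  -- A continuous square root of `p = γ + iα` turns the frame `e, f` into isotropic directions.
  set p : ℝ → ℂ := fun t ↦ ⟨γ t, α t⟩ with hp
  have hpc : Continuous p := by
    have : p = fun t ↦ (γ t : ℂ) + α t * Complex.I := by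
      ext t; exact Complex.mk_eq_add_mul_I _ _
    rw [this]; fun_prop
  have hsc : IsSimplyConnected (Set.univ : Set ℝ) :=
    have := convex_univ.contractibleSpace (Set.univ_nonempty (α := ℝ))
    SimplyConnectedSpace.ofContractible _
  obtain ⟨h, hhc, hh⟩ := Complex.exists_continuousOn_pow_eq hsc isOpen_univ
    hpc.continuousOn (by rintro ⟨t, -, ht⟩; exact hne t ht) two_ne_zero
  rw [continuousOn_univ] at hhc
  have hh0 : ∀ t, h t ≠ 0 := fun t h0 ↦ hne t (show p t = 0 by rw [← hh t, h0]; norm_num)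
  -- `w₀` gives the coordinates of the second standard basis vector `b` in the frame at `t₀`.
  set b : Fin 3 → ℝ := ![0, 1, 0] with hb
  set w₀ : ℂ := ⟨e t₀ ⬝ᵥ b, f t₀ ⬝ᵥ b⟩ with hw₀
  have hbw : w₀.re • e t₀ + w₀.im • f t₀ = b := by
    have h1 : (F t₀)ᵀ *ᵥ (F t₀ *ᵥ b) = b := by rw [mulVec_mulVec, hFF', one_mulVec]
    have h2 : F t₀ *ᵥ b = ![u t₀ ⬝ᵥ b, e t₀ ⬝ᵥ b, f t₀ ⬝ᵥ b] := by
      ext i; fin_cases i <;> rfl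
    have h3 : u t₀ ⬝ᵥ b = 0 := by simp [ht₀, hb]
    rw [h2, h3] at h1
    conv_rhs => rw [← h1]
    ext i
    simp [mulVec, dotProduct, Fin.sum_univ_three, hF, hw₀]
    ring
  have hw₀n : w₀.re ^ 2 + w₀.im ^ 2 = 1 := by
    rw [← hnorm t₀, hbw]; simp [hb]
  have hw₀i : (p t₀ * w₀ ^ 2).im = 0 := by
    have h1 : b ⬝ᵥ M *ᵥ b = 0 := by
      simp [hb, mulVec, dotProduct, Fin.sum_univ_three, hdiag]
    rw [← hbw, hquad] at h1
    simp only [hp, sq, Complex.mul_im, Complex.mul_re]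
    linarith
  -- Since `p * conj h ^ 2 = ‖h‖ ^ 4` is real, so is `p * w ^ 2`: this is isotropy of
  -- `re w • e + im w • f`.
  set k : ℝ → ℝ := fun t ↦ (‖h t₀‖ * ‖h t‖)⁻¹ with hk
  set w : ℝ → ℂ := fun t ↦ w₀ * h t₀ * (starRingEnd ℂ) (h t) * k t with hw
  have hkc : Continuous k := (continuous_const.mul hhc.norm).inv₀ fun t ↦
    mul_ne_zero (norm_ne_zero_iff.2 (hh0 _)) (norm_ne_zero_iff.2 (hh0 _))
  have hwc : Continuous w := by
    have := Complex.continuous_conj.comp hhc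
    have := Complex.continuous_ofReal.comp hkc
    simp only [Function.comp_def] at *
    fun_prop
  have hwn : ∀ t, (w t).re ^ 2 + (w t).im ^ 2 = 1 := fun t ↦ by
    have h1 : ‖w₀‖ = 1 := by
      rw [← Real.sqrt_one, ← hw₀n, ← Complex.norm_eq_sqrt_sq_add_sq]
    have h2 : ‖w t‖ = 1 := by
      have := norm_ne_zero_iff.2 (hh0 t)
      have := norm_ne_zero_iff.2 (hh0 t₀)
      simp only [hw, hk, norm_mul, h1, RCLike.norm_conj, Complex.norm_real, norm_inv, norm_norm]
      field_simp
    rw [Complex.norm_eq_sqrt_sq_add_sq] at h2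
    exact Real.sqrt_eq_one.1 h2
  have hwi : ∀ t, α t * ((w t).re ^ 2 - (w t).im ^ 2) + 2 * γ t * ((w t).re * (w t).im) = 0 :=
    fun t ↦ by
    have h1 : p t * w t ^ 2 = (p t₀ * w₀ ^ 2) * ((Complex.normSq (p t) * k t ^ 2 : ℝ) : ℂ) := by
      have : (Complex.normSq (p t) : ℂ) = p t * (starRingEnd ℂ) (p t) := by
        rw [Complex.mul_conj]
      push_cast
      rw [this, ← hh t, ← hh t₀]
      simp only [hw, map_pow]
      ring
    have h2 : (p t * w t ^ 2).im = 0 := by rw [h1, Complex.im_mul_ofReal, hw₀i, zero_mul]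
    simp only [hp, sq, Complex.mul_im, Complex.mul_re] at h2
    linarith
  have hw0 : w t₀ = w₀ := by
    have h1 : h t₀ * (starRingEnd ℂ) (h t₀) = ((‖h t₀‖ * ‖h t₀‖ : ℝ) : ℂ) := by
      rw [Complex.mul_conj, Complex.normSq_eq_norm_sq, sq]
    have h2 := norm_ne_zero_iff.2 (hh0 t₀)
    simp only [hw, hk]
    rw [mul_assoc w₀, h1, mul_assoc, ← Complex.ofReal_mul, mul_inv_cancel₀ (mul_ne_zero h2 h2)]
    simp
  set w1 : ℝ → Fin 3 → ℝ := fun t ↦ (w t).re • e t + (w t).im • f t with hw1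
  set w2 : ℝ → Fin 3 → ℝ := fun t ↦ (-(w t).im) • e t + (w t).re • f t with hw2
  have hwre : Continuous fun t ↦ (w t).re := Complex.continuous_re.comp hwc
  have hwim : Continuous fun t ↦ (w t).im := Complex.continuous_im.comp hwc
  have hw1c : Continuous w1 := (hwre.smul hec).add (hwim.smul hfc)
  have hw2c : Continuous w2 := (hwim.neg.smul hec).add (hwre.smul hfc)
  have h11 : ∀ t, w1 t ⬝ᵥ w1 t = 1 := fun t ↦ by rw [hnorm, hwn]
  have h22 : ∀ t, w2 t ⬝ᵥ w2 t = 1 := fun t ↦ by rw [hnorm, ← hwn t]; ring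
  have h12 : ∀ t, w1 t ⬝ᵥ w2 t = 0 := fun t ↦ by
    simp only [hw1, hw2, add_dotProduct, dotProduct_add, smul_dotProduct,
      dotProduct_smul, smul_eq_mul, hee, hff, hef, hfe]
    ring
  have hu1' : ∀ t, u t ⬝ᵥ w1 t = 0 := fun t ↦ by
    simp [hw1, dotProduct_add, hue, huf]
  have hu2' : ∀ t, u t ⬝ᵥ w2 t = 0 := fun t ↦ by
    simp [hw2, dotProduct_add, hue, huf]
  refine ⟨fun t ↦ (Matrix.of ![u t, w1 t, w2 t])ᵀ, ?_, fun t ↦ ?_, fun t i ↦ ?_, fun t i ↦ rfl, ?_⟩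
  · refine Continuous.matrix_transpose (continuous_pi fun i ↦ ?_)
    fin_cases i
    exacts [hu, hw1c, hw2c]
  · ext i j
    rw [transpose_transpose]
    change (![u t, w1 t, w2 t] : Fin 3 → Fin 3 → ℝ) i ⬝ᵥ
      (![u t, w1 t, w2 t] : Fin 3 → Fin 3 → ℝ) j = _
    fin_cases i <;> fin_cases j
    exacts [hu1 t, hu1' t, hu2' t, (dotProduct_comm _ _).trans (hu1' t), h11 t, h12 t,
      (dotProduct_comm _ _).trans (hu2' t), (dotProduct_comm _ _).trans (h12 t), h22 t]
  · rw [transpose_transpose, mul_mul_transpose_apply]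
    fin_cases i
    · exact hu0 t
    · exact (hquad t _ _).trans (hwi t)
    · refine (hquad t _ _).trans ?_
      linarith [hwi t]
  · have hb1 : w1 t₀ = b := by simp only [hw1, hw0, hbw]
    have hb2 : w2 t₀ = crossProduct (u t₀) (w1 t₀) := by
      have : crossProduct (u t₀) (f t₀) = - e t₀ := by
        simp only [hf]
        rw [cross_cross_eq_smul_sub_smul']
        simp [hu1, hue]
      simp only [hw1, hw2, map_add, map_smul, this, smul_neg, neg_smul]
      rw [add_comm]
    rw [hb1, ht₀] at hb2
    ext i j
    simp only [hb1, hb2, ht₀, hb]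
    fin_cases i <;> fin_cases j <;> simp [cross_apply]

/-- Let `M` be a form on `ℝ³` that vanishes on the standard basis and has nonzero off-diagonal entries.
If `M 0 1 * a 1` and `M 0 2 * a 2` have opposite signs, then the standard basis can be moved through
isotropic orthonormal bases until its first vector is orthogonal to `a`. -/
theorem exists_isotropic_path_of_mul_neg {M : Matrix (Fin 3) (Fin 3) ℝ} (hM : Mᵀ = M)
    (hdiag : ∀ p, M p p = 0) (h12 : M 1 2 ≠ 0) {a : Fin 3 → ℝ}
    (hneg : (M 0 1 * a 1) * (M 0 2 * a 2) < 0) :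
    ∃ (K : ℝ → Matrix (Fin 3) (Fin 3) ℝ) (t₀ t₁ : ℝ), Continuous K ∧
      (∀ t, (K t)ᵀ * K t = 1) ∧ (∀ t p, ((K t)ᵀ * M * K t) p p = 0) ∧ K t₀ = 1 ∧
      ((K t₁)ᵀ *ᵥ a) 0 = 0 := by
  obtain ⟨x, hx⟩ : ∃ x, x = M 0 1 := ⟨_, rfl⟩
  obtain ⟨y, hy⟩ : ∃ y, y = M 0 2 := ⟨_, rfl⟩
  obtain ⟨z, hz⟩ : ∃ z, z = M 1 2 := ⟨_, rfl⟩
  have hsym : ∀ i j, M i j = M j i := fun i j ↦ congrFun (congrFun hM j) i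
  have h10 : M 1 0 = x := by rw [hx, hsym]
  have h20 : M 2 0 = y := by rw [hy, hsym]
  have h21 : M 2 1 = z := by rw [hz, hsym]
  rw [← hx, ← hy] at hneg
  rw [← hz] at h12
  have hx0 : x ≠ 0 := by rintro rfl; simp at hneg
  have hy0 : y ≠ 0 := by rintro rfl; simp at hneg
  have hMv : ∀ v : Fin 3 → ℝ, M *ᵥ v = ![x * v 1 + y * v 2, x * v 0 + z * v 2, y * v 0 + z * v 1] :=
    fun v ↦ by
    ext i
    fin_cases i <;> simp [mulVec, dotProduct, Fin.sum_univ_three, hdiag, ← hx, ← hy, ← hz, h10,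
      h20, h21]
  have hinj : ∀ v, M *ᵥ v = 0 → v = 0 := fun v hv ↦ by
    rw [hMv] at hv
    have e0 : x * v 1 + y * v 2 = 0 := congrFun hv 0
    have e1 : x * v 0 + z * v 2 = 0 := congrFun hv 1
    have e2 : y * v 0 + z * v 1 = 0 := congrFun hv 2
    have f1 : v 1 = 0 := by
      have : (x * z) * v 1 = 0 := by linear_combination (z * e0 + x * e2 - y * e1) / 2
      simpa [hx0, h12] using this
    have f2 : v 2 = 0 := by simpa [f1, hy0] using e0
    have f0 : v 0 = 0 := by simpa [f1, hy0] using e2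
    ext i; fin_cases i <;> simp [f0, f1, f2]
  -- The isotropic cone is a rational curve, parametrised by the lines through its first axis.
  set t₀ : ℝ := Real.arctan (-x / y) with ht₀
  have hc0 : 0 < Real.cos t₀ := Real.cos_arctan_pos _
  have hL0 : x * Real.cos t₀ + y * Real.sin t₀ = 0 := by
    rw [← Real.tan_mul_cos hc0.ne', ht₀, Real.tan_arctan]
    field_simp; ring
  have hs0 : Real.sin t₀ ≠ 0 := fun h ↦ by
    rw [h] at hL0
    simp [hx0, hc0.ne'] at hL0
  -- The factor `ε` makes the curve pass through the positive half of the first axis at `t₀`.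
  set ε : ℝ := -z * Real.cos t₀ * Real.sin t₀ with hε
  have hε0 : ε ≠ 0 := mul_ne_zero (mul_ne_zero (neg_ne_zero.2 h12) hc0.ne') hs0
  set g : ℝ → Fin 3 → ℝ := fun t ↦ ε • ![-z * Real.cos t * Real.sin t,
    Real.cos t * (x * Real.cos t + y * Real.sin t),
    Real.sin t * (x * Real.cos t + y * Real.sin t)] with hg
  have hgc : Continuous g := by
    refine continuous_pi fun i ↦ ?_
    fin_cases i <;> simp [hg] <;> fun_prop
  have hgne : ∀ t, g t ≠ 0 := fun t h ↦ by
    have h := (smul_eq_zero.1 h).resolve_left hε0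
    have e0 : -z * Real.cos t * Real.sin t = 0 := congrFun h 0
    have e1 : Real.cos t * (x * Real.cos t + y * Real.sin t) = 0 := congrFun h 1
    have e2 : Real.sin t * (x * Real.cos t + y * Real.sin t) = 0 := congrFun h 2
    have := Real.sin_sq_add_cos_sq t
    rcases mul_eq_zero.1 e0 with h' | h'
    · have hc : Real.cos t = 0 := by simpa [h12] using h'
      have hs : Real.sin t = 0 := by simpa [hc, hy0] using e2
      simp [hc, hs] at this
    · have hc : Real.cos t = 0 := by simpa [h', hx0] using e1
      simp [hc, h'] at this
  have hgM : ∀ t, g t ⬝ᵥ M *ᵥ g t = 0 := fun t ↦ by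
    rw [hMv]
    simp [hg, dotProduct, Fin.sum_univ_three]
    ring
  have hgpos : ∀ t, 0 < g t ⬝ᵥ g t := fun t ↦ by
    refine lt_of_le_of_ne (by simpa using dotProduct_self_star_nonneg (g t)) fun h ↦ ?_
    exact hgne t (dotProduct_self_eq_zero.1 h.symm)
  set u : ℝ → Fin 3 → ℝ := fun t ↦ (√(g t ⬝ᵥ g t))⁻¹ • g t with hu
  have hrpos : ∀ t, 0 < √(g t ⬝ᵥ g t) := fun t ↦ Real.sqrt_pos.2 (hgpos t)
  have huc : Continuous u :=
    ((hgc.dotProduct hgc).sqrt.inv₀ fun t ↦ (hrpos t).ne').smul hgc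
  have hu1 : ∀ t, u t ⬝ᵥ u t = 1 := fun t ↦ by
    have h1 := Real.mul_self_sqrt (hgpos t).le
    simp only [hu, smul_dotProduct, dotProduct_smul, smul_eq_mul]
    rw [← mul_assoc, ← mul_inv, h1, inv_mul_cancel₀ (hgpos t).ne']
  have hu0 : ∀ t, u t ⬝ᵥ M *ᵥ u t = 0 := fun t ↦ by
    simp [hu, mulVec_smul, hgM]
  have hut₀ : u t₀ = ![1, 0, 0] := by
    have h1 : g t₀ = ![ε * ε, 0, 0] := by
      ext i; fin_cases i <;> simp [hg, hL0, hε]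
    have h2 : g t₀ ⬝ᵥ g t₀ = (ε * ε) * (ε * ε) := by rw [h1]; simp
    have h3 : √(g t₀ ⬝ᵥ g t₀) = ε * ε := by rw [h2, Real.sqrt_mul_self (mul_self_nonneg ε)]
    simp only [hu]
    rw [h3, h1]
    ext i
    fin_cases i
    · exact inv_mul_cancel₀ (mul_ne_zero hε0 hε0)
    · simp
    · simp
  obtain ⟨K, hKc, hK1, hK0, hKu, hKt⟩ :=
    exists_continuous_isotropic_frame hM hdiag hinj huc hu1 hu0 hut₀
  -- The linear form `a` changes sign along the curve between the parameters `0` and `π / 2`.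
  have hcont : Continuous fun t ↦ g t ⬝ᵥ a := hgc.dotProduct continuous_const
  have hg0 : g 0 ⬝ᵥ a = ε * (x * a 1) := by simp [hg, dotProduct, Fin.sum_univ_three]; ring
  have hg1 : g (Real.pi / 2) ⬝ᵥ a = ε * (y * a 2) := by
    simp [hg, dotProduct, Fin.sum_univ_three]; ring
  have hzero : (0 : ℝ) ∈ Set.range fun t ↦ g t ⬝ᵥ a := by
    have hε2 : 0 < ε * ε := mul_self_pos.2 hε0
    have : (g 0 ⬝ᵥ a) * (g (Real.pi / 2) ⬝ᵥ a) < 0 := by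
      rw [hg0, hg1]; nlinarith
    rcases mul_neg_iff.1 this with h | h
    · exact mem_range_of_exists_le_of_exists_ge hcont ⟨_, h.2.le⟩ ⟨_, h.1.le⟩
    · exact mem_range_of_exists_le_of_exists_ge hcont ⟨_, h.1.le⟩ ⟨_, h.2.le⟩
  obtain ⟨t₁, ht₁⟩ := hzero
  refine ⟨K, t₀, t₁, hKc, hK1, hK0, hKt, ?_⟩
  have : ((K t₁)ᵀ *ᵥ a) 0 = u t₁ ⬝ᵥ a := by
    simp [mulVec, dotProduct, hKu]
  rw [this]
  simp only [hu, smul_dotProduct]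
  rw [show g t₁ ⬝ᵥ a = 0 from ht₁, smul_zero]

/-! ### Isotropic bases and their elementary moves -/

section Moves

variable {n m : Type*} [Fintype n] [DecidableEq n] [Fintype m] [DecidableEq m]

/-- The orthogonal matrices whose columns are isotropic for the quadratic form of `B`, i.e. the
orthonormal bases of `ℝⁿ` consisting of isotropic vectors. Both orientations are allowed. -/
def isotropicBases (B : Matrix n n ℝ) : Set (Matrix n n ℝ) :=
  {Q | Qᵀ * Q = 1 ∧ ∀ k, (Qᵀ * B * Q) k k = 0}

/-- The `n × n` matrix acting as `K` on the coordinates in the range of `ι` and as the identity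
on the others. -/
def blockExtend (ι : m → n) (K : Matrix m m ℝ) : Matrix n n ℝ :=
  (1 : Matrix n n ℝ).submatrix id ι * K * ((1 : Matrix n n ℝ).submatrix id ι)ᵀ +
    (1 - (1 : Matrix n n ℝ).submatrix id ι * ((1 : Matrix n n ℝ).submatrix id ι)ᵀ)

variable {ι : m → n}

theorem transpose_inclusion_mul (hι : Function.Injective ι) :
    ((1 : Matrix n n ℝ).submatrix id ι)ᵀ * (1 : Matrix n n ℝ).submatrix id ι = 1 := by
  ext p q
  simp [mul_apply, one_apply, hι.eq_iff]

theorem transpose_blockExtend (K : Matrix m m ℝ) :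
    (blockExtend ι K)ᵀ = blockExtend ι Kᵀ := by
  simp [blockExtend, transpose_mul, Matrix.mul_assoc]

theorem blockExtend_mul (hι : Function.Injective ι) (K L : Matrix m m ℝ) :
    blockExtend ι K * blockExtend ι L = blockExtend ι (K * L) := by
  have h := transpose_inclusion_mul hι
  simp only [blockExtend]
  generalize (1 : Matrix n n ℝ).submatrix id ι = E at *
  have h' : ∀ X : Matrix m n ℝ, Eᵀ * (E * X) = X := fun X ↦ by
    rw [← Matrix.mul_assoc, h, Matrix.one_mul]
  simp only [Matrix.mul_add, Matrix.add_mul, Matrix.mul_sub, Matrix.sub_mul, Matrix.mul_assoc, h',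
    Matrix.mul_one, Matrix.one_mul]
  abel

@[simp] theorem blockExtend_one : blockExtend ι (1 : Matrix m m ℝ) = 1 := by
  simp [blockExtend]

theorem blockExtend_orthogonal (hι : Function.Injective ι) {K : Matrix m m ℝ}
    (hK : Kᵀ * K = 1) : (blockExtend ι K)ᵀ * blockExtend ι K = 1 := by
  rw [transpose_blockExtend, blockExtend_mul hι, hK, blockExtend_one]

theorem continuous_blockExtend : Continuous (blockExtend (n := n) ι) := by
  unfold blockExtend
  fun_prop

/-- Columns outside of the range of `ι` are not changed. -/
theorem mul_blockExtend_apply_of_notMem {l : Type*} (A : Matrix l n ℝ) (K : Matrix m m ℝ) {k : n}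
    (hk : k ∉ Set.range ι) (i : l) : (A * blockExtend ι K) i k = A i k := by
  have h0 : ∀ p, (1 : Matrix n n ℝ) k (ι p) = 0 := fun p ↦
    one_apply_ne fun h ↦ hk ⟨p, h.symm⟩
  have h1 : ∀ X : Matrix l m ℝ, (X * ((1 : Matrix n n ℝ).submatrix id ι)ᵀ) i k = 0 := fun X ↦
    Finset.sum_eq_zero fun p _ ↦ mul_eq_zero_of_right _ (h0 p)
  rw [blockExtend, Matrix.mul_add, Matrix.mul_sub, Matrix.add_apply, Matrix.sub_apply,
    ← Matrix.mul_assoc A (_ * K), h1, ← Matrix.mul_assoc A, h1, Matrix.mul_one]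
  ring

theorem mul_blockExtend_apply {l : Type*} (hι : Function.Injective ι) (A : Matrix l n ℝ)
    (K : Matrix m m ℝ) (i : l) (p : m) :
    (A * blockExtend ι K) i (ι p) = (A.submatrix id ι * K) i p := by
  have h1 : blockExtend ι K * (1 : Matrix n n ℝ).submatrix id ι =
      (1 : Matrix n n ℝ).submatrix id ι * K := by
    have h := transpose_inclusion_mul hι
    simp only [blockExtend, Matrix.add_mul, Matrix.sub_mul, Matrix.mul_assoc, h]
    simp
  have h2 : ∀ A : Matrix l n ℝ, A.submatrix id ι = A * (1 : Matrix n n ℝ).submatrix id ι :=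
    fun A ↦ by
    ext i p
    simp [mul_apply, one_apply]
  rw [h2, Matrix.mul_assoc, ← h1, ← Matrix.mul_assoc, ← h2]
  rfl

theorem gram_mul_blockExtend_of_notMem (M : Matrix n n ℝ) (K : Matrix m m ℝ) {k l : n}
    (hk : k ∉ Set.range ι) (hl : l ∉ Set.range ι) :
    ((blockExtend ι K)ᵀ * M * blockExtend ι K) k l = M k l := by
  rw [mul_blockExtend_apply_of_notMem _ _ hl, ← transpose_apply (_ * _), transpose_mul,
    transpose_transpose, mul_blockExtend_apply_of_notMem _ _ hk, transpose_apply]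

theorem gram_mul_blockExtend (hι : Function.Injective ι) (M : Matrix n n ℝ) (K : Matrix m m ℝ)
    (p q : m) : ((blockExtend ι K)ᵀ * M * blockExtend ι K) (ι p) (ι q) =
      (Kᵀ * M.submatrix ι ι * K) p q := by
  rw [mul_blockExtend_apply hι, mul_apply, mul_apply]
  refine Finset.sum_congr rfl fun r _ ↦ ?_
  congr 1
  rw [submatrix_apply, id, ← transpose_apply (_ * _), transpose_mul, transpose_transpose,
    mul_blockExtend_apply hι, ← transpose_apply (_ * _), transpose_mul, transpose_submatrix,
    transpose_transpose]
  rfl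

theorem orthogonal_mul {Q G : Matrix n n ℝ} (hQ : Qᵀ * Q = 1) (hG : Gᵀ * G = 1) :
    (Q * G)ᵀ * (Q * G) = 1 := by
  rw [transpose_mul, Matrix.mul_assoc, ← Matrix.mul_assoc Qᵀ, hQ, Matrix.one_mul, hG]

theorem orthogonal_transpose_mul {Q G : Matrix n n ℝ} (hQ : Qᵀ * Q = 1) (hG : Gᵀ * G = 1) :
    (Qᵀ * G)ᵀ * (Qᵀ * G) = 1 :=
  orthogonal_mul (by rw [transpose_transpose, mul_eq_one_comm.1 hQ]) hG

theorem transpose_mul_mul_mul (Q B G : Matrix n n ℝ) :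
    (Q * G)ᵀ * B * (Q * G) = Gᵀ * (Qᵀ * B * Q) * G := by
  simp only [transpose_mul, Matrix.mul_assoc]

variable {B : Matrix n n ℝ}

/-- Changing the basis vectors indexed by the range of `ι` by `K` preserves isotropy as soon as the
diagonal of `Kᵀ M K` vanishes, where `M` is the matrix of `B` in these basis vectors. -/
theorem mul_blockExtend_mem {Q : Matrix n n ℝ} (hQ : Q ∈ isotropicBases B)
    (hι : Function.Injective ι) {K : Matrix m m ℝ} (hK : Kᵀ * K = 1)
    (hK0 : ∀ p, (Kᵀ * (Qᵀ * B * Q).submatrix ι ι * K) p p = 0) :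
    Q * blockExtend ι K ∈ isotropicBases B := by
  refine ⟨orthogonal_mul hQ.1 (blockExtend_orthogonal hι hK), fun k ↦ ?_⟩
  rw [transpose_mul_mul_mul]
  by_cases hk : k ∈ Set.range ι
  · obtain ⟨p, rfl⟩ := hk
    rw [gram_mul_blockExtend hι, hK0]
  · rw [gram_mul_blockExtend_of_notMem _ _ hk hk, hQ.2]

theorem joinedIn_mul_blockExtend {Q : Matrix n n ℝ} (hQ : Q ∈ isotropicBases B)
    (hι : Function.Injective ι) {K : ℝ → Matrix m m ℝ} (hKc : Continuous K)
    (hK : ∀ t, (K t)ᵀ * K t = 1)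
    (hK0 : ∀ t p, ((K t)ᵀ * (Qᵀ * B * Q).submatrix ι ι * K t) p p = 0) {t₀ : ℝ} (ht₀ : K t₀ = 1)
    (t₁ : ℝ) : JoinedIn (isotropicBases B) Q (Q * blockExtend ι (K t₁)) := by
  have hc : Continuous fun t ↦ Q * blockExtend ι (K t) :=
    continuous_const.matrix_mul (continuous_blockExtend.comp hKc)
  have h := (isPathConnected_univ (X := ℝ)).image hc
  have h' := h.joinedIn _ ⟨t₀, trivial, rfl⟩ _ ⟨t₁, trivial, rfl⟩
  simp only [ht₀, blockExtend_one, Matrix.mul_one] at h'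
  refine h'.mono ?_
  rintro _ ⟨t, -, rfl⟩
  exact mul_blockExtend_mem hQ hι (hK t) (hK0 t)

/-- The rotation of the coordinate plane of `i` and `j` by the angle `t`. -/
noncomputable def planeRotation (i j : n) (t : ℝ) : Matrix n n ℝ :=
  blockExtend ![i, j] !![Real.cos t, -Real.sin t; Real.sin t, Real.cos t]

theorem injective_pair {i j : n} (hij : i ≠ j) : Function.Injective ![i, j] := by
  intro p q h
  fin_cases p <;> fin_cases q <;> simp_all [hij.symm]

theorem mul_planeRotation_left {l : Type*} {i j : n} (hij : i ≠ j) (A : Matrix l n ℝ) (t : ℝ)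
    (r : l) : (A * planeRotation i j t) r i = Real.cos t * A r i + Real.sin t * A r j := by
  refine (mul_blockExtend_apply (injective_pair hij) A _ r 0).trans ?_
  simp [mul_apply]
  ring

theorem mul_planeRotation_right {l : Type*} {i j : n} (hij : i ≠ j) (A : Matrix l n ℝ) (t : ℝ)
    (r : l) : (A * planeRotation i j t) r j = -Real.sin t * A r i + Real.cos t * A r j := by
  refine (mul_blockExtend_apply (injective_pair hij) A _ r 1).trans ?_
  simp [mul_apply]
  ring

theorem mul_planeRotation_of_ne {l : Type*} {i j k : n} (hi : k ≠ i) (hj : k ≠ j)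
    (A : Matrix l n ℝ) (t : ℝ) (r : l) : (A * planeRotation i j t) r k = A r k :=
  mul_blockExtend_apply_of_notMem _ _ (by
    rintro ⟨p, hp⟩
    fin_cases p
    exacts [hi hp.symm, hj hp.symm]) _

end Moves

/-! ### Plane rotations and quarter turns -/

section Rotations

variable {n : Type*} [Fintype n] [DecidableEq n] {B : Matrix n n ℝ}

theorem transpose_planeRotation_mul_left {l : Type*} {i j : n} (hij : i ≠ j) (A : Matrix n l ℝ)
    (t : ℝ) (r : l) :
    ((planeRotation i j t)ᵀ * A) i r = Real.cos t * A i r + Real.sin t * A j r := by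
  rw [← transpose_apply (_ * _), transpose_mul, transpose_transpose, mul_planeRotation_left hij]
  rfl

theorem transpose_planeRotation_mul_right {l : Type*} {i j : n} (hij : i ≠ j) (A : Matrix n l ℝ)
    (t : ℝ) (r : l) :
    ((planeRotation i j t)ᵀ * A) j r = -Real.sin t * A i r + Real.cos t * A j r := by
  rw [← transpose_apply (_ * _), transpose_mul, transpose_transpose, mul_planeRotation_right hij]
  rfl

theorem transpose_planeRotation_mul_of_ne {l : Type*} {i j k : n} (hi : k ≠ i) (hj : k ≠ j)
    (A : Matrix n l ℝ) (t : ℝ) (r : l) : ((planeRotation i j t)ᵀ * A) k r = A k r := by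
  rw [← transpose_apply (_ * _), transpose_mul, transpose_transpose,
    mul_planeRotation_of_ne hi hj]
  rfl

theorem rotation_orthogonal (t : ℝ) :
    (!![Real.cos t, -Real.sin t; Real.sin t, Real.cos t])ᵀ *
      !![Real.cos t, -Real.sin t; Real.sin t, Real.cos t] = 1 := by
  have := Real.sin_sq_add_cos_sq t
  ext p q
  fin_cases p <;> fin_cases q <;> simp [mul_apply] <;> linarith

theorem planeRotation_orthogonal {i j : n} (hij : i ≠ j) (t : ℝ) :
    (planeRotation i j t)ᵀ * planeRotation i j t = 1 :=
  blockExtend_orthogonal (injective_pair hij) (rotation_orthogonal t)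

theorem gram_symm (hB : Bᵀ = B) (Q : Matrix n n ℝ) (i j : n) :
    (Qᵀ * B * Q) i j = (Qᵀ * B * Q) j i := by
  rw [← transpose_apply (_ * Q)]
  simp only [transpose_mul, transpose_transpose, hB, Matrix.mul_assoc]

/-- Two basis vectors that are orthogonal for `B` can be rotated freely in their plane. -/
theorem joinedIn_mul_planeRotation (hB : Bᵀ = B) {Q : Matrix n n ℝ} (hQ : Q ∈ isotropicBases B)
    {i j : n} (hij : i ≠ j) (h : (Qᵀ * B * Q) i j = 0) (t : ℝ) :
    JoinedIn (isotropicBases B) Q (Q * planeRotation i j t) := by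
  have h' := (gram_symm hB Q i j).symm.trans h
  have hz : (Qᵀ * B * Q).submatrix ![i, j] ![i, j] = 0 := by
    ext p q
    fin_cases p <;> fin_cases q
    exacts [hQ.2 i, h, h', hQ.2 j]
  refine joinedIn_mul_blockExtend hQ (injective_pair hij) (t₀ := 0)
    (K := fun t ↦ !![Real.cos t, -Real.sin t; Real.sin t, Real.cos t]) ?_ rotation_orthogonal ?_ ?_ t
  · refine continuous_matrix fun p q ↦ ?_
    fin_cases p <;> fin_cases q <;> simp <;> fun_prop
  · intro t p
    simp [hz]
  · ext p q
    fin_cases p <;> fin_cases q <;> simp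

/-- A quarter turn permutes two basis vectors up to sign, hence preserves isotropy. -/
theorem mul_quarterTurn_mem {Q : Matrix n n ℝ} (hQ : Q ∈ isotropicBases B)
    {i j : n} (hij : i ≠ j) : Q * planeRotation i j (Real.pi / 2) ∈ isotropicBases B := by
  refine mul_blockExtend_mem hQ (injective_pair hij) (rotation_orthogonal _) fun p ↦ ?_
  have hi : (Qᵀ * B * Q).submatrix ![i, j] ![i, j] 0 0 = 0 := hQ.2 i
  have hj : (Qᵀ * B * Q).submatrix ![i, j] ![i, j] 1 1 = 0 := hQ.2 j
  generalize (Qᵀ * B * Q).submatrix ![i, j] ![i, j] = S at *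
  simp only [mul_apply, Fin.sum_univ_two, transpose_apply]
  fin_cases p <;> simp [hi, hj]

theorem joinedIn_mul_quarterTurn {Q Q' : Matrix n n ℝ}
    (h : JoinedIn (isotropicBases B) Q Q') {i j : n} (hij : i ≠ j) :
    JoinedIn (isotropicBases B) (Q * planeRotation i j (Real.pi / 2))
      (Q' * planeRotation i j (Real.pi / 2)) := by
  have hc : Continuous fun X : Matrix n n ℝ ↦ X * planeRotation i j (Real.pi / 2) := by fun_prop
  refine (h.map_continuousOn hc.continuousOn).mono ?_
  rintro _ ⟨X, hX, rfl⟩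
  exact mul_quarterTurn_mem hX hij

theorem exists_cos_mul_add_sin_mul_eq_zero (p q : ℝ) :
    ∃ t, Real.cos t * p + Real.sin t * q = 0 := by
  by_cases hq : q = 0
  · exact ⟨Real.pi / 2, by simp [hq]⟩
  · refine ⟨Real.arctan (-p / q), ?_⟩
    rw [← Real.tan_mul_cos (Real.cos_arctan_pos _).ne', Real.tan_arctan]
    field_simp
    ring

/-- If `q a` and `q b` are orthogonal for `B`, a rotation of the two makes `q a` orthogonal to a
third basis vector `q c`. -/
theorem exists_joinedIn_gram_eq_zero (hB : Bᵀ = B) {Q : Matrix n n ℝ} (hQ : Q ∈ isotropicBases B)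
    {a b c : n} (hab : a ≠ b) (h : (Qᵀ * B * Q) a b = 0) (hca : c ≠ a) :
    ∃ Q', JoinedIn (isotropicBases B) Q Q' ∧ (Q'ᵀ * B * Q') a c = 0 := by
  by_cases hcb : c = b
  · exact ⟨Q, JoinedIn.refl hQ, hcb ▸ h⟩
  obtain ⟨t, ht⟩ := exists_cos_mul_add_sin_mul_eq_zero ((Qᵀ * B * Q) a c) ((Qᵀ * B * Q) b c)
  refine ⟨_, joinedIn_mul_planeRotation hB hQ hab h t, ?_⟩
  rw [transpose_mul_mul_mul, mul_planeRotation_of_ne hca hcb, transpose_planeRotation_mul_left hab,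
    ht]

/-- If some two vectors of the basis `Q` are orthogonal for `B`, then `Q` can be joined to each of its
quarter turns: a path from `Q` leads to a basis in which the `i`-th and `j`-th vectors are
orthogonal for `B`, and there the quarter turn is the endpoint of a rotation in their plane. -/
theorem joinedIn_quarterTurn_of_gram_eq_zero (hB : Bᵀ = B) {Q : Matrix n n ℝ}
    (hQ : Q ∈ isotropicBases B) {a b : n} (hab : a ≠ b) (h : (Qᵀ * B * Q) a b = 0) {i j : n}
    (hij : i ≠ j) : JoinedIn (isotropicBases B) Q (Q * planeRotation i j (Real.pi / 2)) := by
  obtain ⟨Q', hQ', h'⟩ : ∃ Q', JoinedIn (isotropicBases B) Q Q' ∧ (Q'ᵀ * B * Q') i j = 0 := by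
    by_cases hia : i = a
    · subst hia
      exact exists_joinedIn_gram_eq_zero hB hQ hab h hij.symm
    · obtain ⟨Q₁, hQ₁, h₁⟩ := exists_joinedIn_gram_eq_zero hB hQ hab h hia
      rw [gram_symm hB] at h₁
      obtain ⟨Q₂, hQ₂, h₂⟩ := exists_joinedIn_gram_eq_zero hB hQ₁.target_mem hia h₁ hij.symm
      exact ⟨Q₂, hQ₁.trans hQ₂, h₂⟩
  exact (hQ'.trans (joinedIn_mul_planeRotation hB hQ'.target_mem hij h' _)).trans
    (joinedIn_mul_quarterTurn hQ'.symm hij)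

theorem det_mul_self_of_transpose_mul_self {Q : Matrix n n ℝ} (hQ : Qᵀ * Q = 1) :
    Q.det * Q.det = 1 := by
  rw [← det_one (n := n) (R := ℝ), ← hQ, det_mul, det_transpose]

theorem det_eq_of_joinedIn {Q Q' : Matrix n n ℝ} (h : JoinedIn (isotropicBases B) Q Q') :
    Q.det = Q'.det := by
  obtain ⟨γ, hγ⟩ := h
  have hc : Continuous fun t ↦ (γ t).det := γ.continuous.matrix_det
  have hm : Set.MapsTo (fun t ↦ (γ t).det) Set.univ ({1, -1} : Set ℝ) := fun t _ ↦
    mul_self_eq_one_iff.1 (det_mul_self_of_transpose_mul_self (hγ t).1)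
  have := isPreconnected_univ.constant_of_mapsTo (Set.toFinite _).isDiscrete hc.continuousOn hm (Set.mem_univ 0)
    (Set.mem_univ 1)
  simpa using this

end Rotations

/-! ### Matching two isotropic bases -/

section Matching

variable {n m : Type*} [Fintype n] [DecidableEq n] [Fintype m] [DecidableEq m] {B : Matrix n n ℝ}

/-- If the entries of a symmetric array with zero diagonal sum to zero and the entries off the diagonal
of `T × T` do not vanish, then two entries sharing an index have opposite signs: otherwise all
entries would have the same sign. -/
theorem exists_mul_neg_of_sum_eq_zero {c : n → n → ℝ} (hc : ∀ i j, c i j = c j i)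
    (hdiag : ∀ i, c i i = 0) (hsum : ∑ i, ∑ j, c i j = 0) {T : Finset n}
    (hout : ∀ i j, i ∉ T → c i j = 0) (hT : ∀ i ∈ T, ∀ j ∈ T, i ≠ j → c i j ≠ 0)
    (hcard : 1 < T.card) :
    ∃ i ∈ T, ∃ j ∈ T, ∃ l ∈ T, i ≠ j ∧ i ≠ l ∧ j ≠ l ∧ c i j * c i l < 0 := by
  by_contra! hcon
  obtain ⟨i₀, hi₀, j₀, hj₀, h₀⟩ := Finset.one_lt_card.1 hcard
  have hpos : ∀ i ∈ T, ∀ j ∈ T, ∀ l ∈ T, i ≠ j → i ≠ l → 0 < c i j * c i l := by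
    intro i hi j hj l hl hij hil
    by_cases hjl : j = l
    · subst hjl
      exact mul_self_pos.2 (hT i hi j hj hij)
    · exact lt_of_le_of_ne (hcon i hi j hj l hl hij hil hjl)
        (mul_ne_zero (hT i hi j hj hij) (hT i hi l hl hil)).symm
  have htrans : ∀ {x y z : ℝ}, 0 < x * y → 0 < y * z → 0 < x * z := by
    intro x y z hxy hyz
    have hy : y ≠ 0 := by rintro rfl; simp at hxy
    have : 0 < (x * z) * (y * y) := by nlinarith [mul_pos hxy hyz]
    exact (mul_pos_iff_of_pos_right (mul_self_pos.2 hy)).1 this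
  have hall : ∀ i ∈ T, ∀ j ∈ T, i ≠ j → 0 < c i j * c i₀ j₀ := by
    intro i hi j hj hij
    by_cases hij₀ : i = j₀
    · subst hij₀
      rw [hc i₀]
      exact hpos i hi j hj i₀ hi₀ hij h₀.symm
    · refine htrans (hpos i hi j hj j₀ hj₀ hij hij₀) ?_
      rw [hc i, hc i₀]
      exact hpos j₀ hj₀ i hi i₀ hi₀ (Ne.symm hij₀) h₀.symm
  have hnn : ∀ i j, 0 ≤ c i j * c i₀ j₀ := by
    intro i j
    by_cases hi : i ∈ T
    · by_cases hj : j ∈ T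
      · by_cases hij : i = j
        · simp [hij, hdiag]
        · exact (hall i hi j hj hij).le
      · simp [hc i j, hout j i hj]
    · simp [hout i j hi]
  have h1 : 0 < ∑ i, ∑ j, c i j * c i₀ j₀ :=
    Finset.sum_pos' (fun i _ ↦ Finset.sum_nonneg fun j _ ↦ hnn i j) ⟨i₀, Finset.mem_univ _,
      Finset.sum_pos' (fun j _ ↦ hnn i₀ j) ⟨j₀, Finset.mem_univ _, hall i₀ hi₀ j₀ hj₀ h₀⟩⟩
  simp_rw [← Finset.sum_mul] at h1
  rw [hsum, zero_mul] at h1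
  exact lt_irrefl _ h1

/-- The columns of `A` indexed by `S` are standard basis vectors. -/
def MatchedOn (S : Finset n) (A : Matrix n n ℝ) : Prop :=
  ∀ l ∈ S, ∀ r, A r l = (1 : Matrix n n ℝ) r l

theorem transpose_blockExtend_mul_apply_of_notMem {ι : m → n} (A : Matrix n n ℝ)
    (K : Matrix m m ℝ) {r : n} (hr : r ∉ Set.range ι) (l : n) :
    ((blockExtend ι K)ᵀ * A) r l = A r l := by
  rw [← transpose_apply (_ * _), transpose_mul, transpose_transpose,
    mul_blockExtend_apply_of_notMem _ _ hr]
  rfl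

theorem transpose_blockExtend_mul_apply {ι : m → n} (hι : Function.Injective ι)
    (A : Matrix n n ℝ) (K : Matrix m m ℝ) (p : m) (l : n) :
    ((blockExtend ι K)ᵀ * A) (ι p) l = (Kᵀ *ᵥ fun q ↦ A (ι q) l) p := by
  rw [← transpose_apply (_ * _), transpose_mul, transpose_transpose,
    mul_blockExtend_apply hι]
  simp [mul_apply, mulVec, dotProduct, mul_comm]

theorem MatchedOn.transpose_blockExtend_mul {S : Finset n} {A : Matrix n n ℝ} (hA : MatchedOn S A)
    {ι : m → n} (hι : Function.Injective ι) (hS : ∀ p, ι p ∉ S) (K : Matrix m m ℝ) :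
    MatchedOn S ((blockExtend ι K)ᵀ * A) := by
  intro l hl r
  by_cases hr : r ∈ Set.range ι
  · obtain ⟨p, rfl⟩ := hr
    have h : ∀ q, A (ι q) l = 0 := fun q ↦ by
      rw [hA l hl, one_apply_ne]
      rintro rfl
      exact hS q hl
    rw [transpose_blockExtend_mul_apply hι, one_apply_ne (by rintro rfl; exact hS p hl)]
    simp [mulVec, dotProduct, h]
  · rw [transpose_blockExtend_mul_apply_of_notMem _ _ hr, hA l hl]

/-- In an orthogonal matrix, the rows indexed by `S` are standard basis vectors as well. -/
theorem MatchedOn.apply_eq_zero {S : Finset n} {A : Matrix n n ℝ} (hA : MatchedOn S A)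
    (hA1 : Aᵀ * A = 1) {k l : n} (hl : l ∈ S) (hk : k ≠ l) : A l k = 0 := by
  have h : (Aᵀ * A) l k = A l k := by
    rw [mul_apply, Finset.sum_eq_single l]
    · simp [hA l hl]
    · intro r _ hr
      simp [hA l hl, hr]
    · simp
  rw [← h, hA1, one_apply_ne hk.symm]

/-- A move of the basis vectors with indices in the range of `ι` that annihilates one coordinate of
the target vector. -/
theorem exists_joinedIn_card_lt_of_block {Q Q₁ : Matrix n n ℝ} (hQ : Q ∈ isotropicBases B)
    (hQ₁ : Q₁ ∈ isotropicBases B) {S : Finset n} {k : n} (hS : MatchedOn S (Qᵀ * Q₁)) (hk : k ∉ S)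
    {ι : m → n} (hι : Function.Injective ι) (hsupp : ∀ p, (Qᵀ * Q₁) (ι p) k ≠ 0)
    {K : Matrix m m ℝ} (hj : JoinedIn (isotropicBases B) Q (Q * blockExtend ι K)) (p₀ : m)
    (h₀ : (Kᵀ *ᵥ fun q ↦ (Qᵀ * Q₁) (ι q) k) p₀ = 0) :
    ∃ Q', JoinedIn (isotropicBases B) Q Q' ∧ MatchedOn S (Q'ᵀ * Q₁) ∧
      (Finset.univ.filter fun j ↦ (Q'ᵀ * Q₁) j k ≠ 0).card <
        (Finset.univ.filter fun j ↦ (Qᵀ * Q₁) j k ≠ 0).card := by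
  have hA1 := orthogonal_transpose_mul hQ.1 hQ₁.1
  have heq : (Q * blockExtend ι K)ᵀ * Q₁ = (blockExtend ι K)ᵀ * (Qᵀ * Q₁) := by
    rw [transpose_mul, Matrix.mul_assoc]
  refine ⟨_, hj, ?_, ?_⟩
  · rw [heq]
    refine hS.transpose_blockExtend_mul hι (fun p hp ↦ hsupp p ?_) K
    exact hS.apply_eq_zero hA1 hp (by rintro rfl; exact hk hp)
  · rw [heq]
    refine Finset.card_lt_card (Finset.ssubset_iff_of_subset ?_ |>.2 ⟨ι p₀, ?_, ?_⟩)
    · intro r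
      simp only [Finset.mem_filter, Finset.mem_univ, true_and]
      intro hr
      by_cases h : r ∈ Set.range ι
      · obtain ⟨p, rfl⟩ := h
        exact hsupp p
      · rwa [transpose_blockExtend_mul_apply_of_notMem _ _ h] at hr
    · simpa using hsupp p₀
    · simp only [Finset.mem_filter, Finset.mem_univ, true_and, not_not]
      rw [transpose_blockExtend_mul_apply hι, h₀]

/-- If a vector of the isotropic basis `Q₁` has at least two nonzero coordinates in the isotropic basis
`Q`, then `Q` can be moved, keeping the vectors it shares with `Q₁`, so that the number of nonzero
coordinates drops. If two of the basis vectors involved are orthogonal for `B`, rotate them;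
otherwise isotropy of the target vector provides a triple to which
`exists_isotropic_path_of_mul_neg` applies. -/
theorem exists_joinedIn_card_lt (hB : Bᵀ = B) {Q Q₁ : Matrix n n ℝ} (hQ : Q ∈ isotropicBases B)
    (hQ₁ : Q₁ ∈ isotropicBases B) {S : Finset n} {k : n} (hS : MatchedOn S (Qᵀ * Q₁)) (hk : k ∉ S)
    (hcard : 1 < (Finset.univ.filter fun j ↦ (Qᵀ * Q₁) j k ≠ 0).card) :
    ∃ Q', JoinedIn (isotropicBases B) Q Q' ∧ MatchedOn S (Q'ᵀ * Q₁) ∧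
      (Finset.univ.filter fun j ↦ (Q'ᵀ * Q₁) j k ≠ 0).card <
        (Finset.univ.filter fun j ↦ (Qᵀ * Q₁) j k ≠ 0).card := by
  set A := Qᵀ * Q₁ with hA
  set M := Qᵀ * B * Q with hM
  have hMs : ∀ i j, M i j = M j i := gram_symm hB Q
  by_cases hex : ∃ i j, i ≠ j ∧ A i k ≠ 0 ∧ A j k ≠ 0 ∧ M i j = 0
  · obtain ⟨i, j, hij, hi, hj, h⟩ := hex
    obtain ⟨t, ht⟩ := exists_cos_mul_add_sin_mul_eq_zero (A i k) (A j k)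
    refine exists_joinedIn_card_lt_of_block hQ hQ₁ hS hk (injective_pair hij) ?_
      (joinedIn_mul_planeRotation hB hQ hij h t) 0 ?_
    · intro p
      fin_cases p
      exacts [hi, hj]
    · simpa [mulVec, dotProduct] using ht
  · push Not at hex
    have hiso : ∑ i, ∑ j, A i k * M i j * A j k = 0 := by
      have h1 : (Aᵀ * M * A) k k = 0 := by
        have : Aᵀ * M * A = Q₁ᵀ * B * Q₁ := by
          have h2 := mul_eq_one_comm.1 hQ.1
          rw [hA, hM, transpose_mul, transpose_transpose]
          calc Q₁ᵀ * Q * (Qᵀ * B * Q) * (Qᵀ * Q₁)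
              = Q₁ᵀ * (Q * Qᵀ) * B * (Q * Qᵀ) * Q₁ := by simp only [Matrix.mul_assoc]
            _ = Q₁ᵀ * B * Q₁ := by rw [h2, Matrix.mul_one, Matrix.mul_one]
        rw [this, hQ₁.2]
      rw [← h1, mul_apply, Finset.sum_comm]
      simp_rw [mul_apply, Finset.sum_mul, transpose_apply]
    obtain ⟨i, hi, j, hj, l, hl, hij, hil, hjl, hneg⟩ :=
      exists_mul_neg_of_sum_eq_zero (c := fun i j ↦ A i k * M i j * A j k)
        (T := Finset.univ.filter fun j ↦ A j k ≠ 0)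
        (fun i j ↦ by rw [hMs i j]; ring) (fun i ↦ by rw [show M i i = 0 from hQ.2 i]; ring) hiso
        (fun i j hi ↦ by
          have : A i k = 0 := by simpa using hi
          simp [this])
        (fun i hi j hj hij ↦ by
          simp only [Finset.mem_filter, Finset.mem_univ, true_and] at hi hj
          exact mul_ne_zero (mul_ne_zero hi (hex i j hij hi hj)) hj) hcard
    simp only [Finset.mem_filter, Finset.mem_univ, true_and] at hi hj hl
    have hinj : Function.Injective ![i, j, l] := by
      intro p q h
      fin_cases p <;> fin_cases q <;> simp_all [hij.symm, hil.symm, hjl.symm]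
    have hneg' : (M i j * A j k) * (M i l * A l k) < 0 := by
      have h1 : 0 < A i k * A i k := mul_self_pos.2 hi
      have h2 : (A i k * A i k) * ((M i j * A j k) * (M i l * A l k)) < 0 := by
        linarith
      by_contra! h
      linarith [mul_nonneg h1.le h]
    obtain ⟨K, t₀, t₁, hKc, hK1, hK0, hKt, hz⟩ := exists_isotropic_path_of_mul_neg
      (M := M.submatrix ![i, j, l] ![i, j, l]) (a := fun q ↦ A (![i, j, l] q) k)
      (by ext p q; exact hMs _ _) (fun p ↦ hQ.2 _) (hex j l hjl hj hl) hneg'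
    refine exists_joinedIn_card_lt_of_block hQ hQ₁ hS hk hinj ?_
      (joinedIn_mul_blockExtend hQ hinj hKc hK1 hK0 hKt t₁) 0 hz
    intro p
    fin_cases p
    exacts [hi, hj, hl]

/-- The basis `Q` can be moved until one of its vectors is the `k`-th vector of `Q₁` up to sign. -/
theorem exists_joinedIn_single {Q₁ : Matrix n n ℝ} (hB : Bᵀ = B) (hQ₁ : Q₁ ∈ isotropicBases B)
    {S : Finset n} {k : n} (hk : k ∉ S) {Q : Matrix n n ℝ} (hQ : Q ∈ isotropicBases B)
    (hS : MatchedOn S (Qᵀ * Q₁)) :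
    ∃ Q', JoinedIn (isotropicBases B) Q Q' ∧ MatchedOn S (Q'ᵀ * Q₁) ∧
      ∃ j, (∀ r, r ≠ j → (Q'ᵀ * Q₁) r k = 0) ∧
        ((Q'ᵀ * Q₁) j k = 1 ∨ (Q'ᵀ * Q₁) j k = -1) := by
  induction hc : (Finset.univ.filter fun j ↦ (Qᵀ * Q₁) j k ≠ 0).card using
    Nat.strong_induction_on generalizing Q with
  | _ c ih =>
    by_cases h1 : 1 < (Finset.univ.filter fun j ↦ (Qᵀ * Q₁) j k ≠ 0).card
    · obtain ⟨Q', hj, hS', hlt⟩ := exists_joinedIn_card_lt hB hQ hQ₁ hS hk h1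
      obtain ⟨Q'', hj', h⟩ := ih _ (hc ▸ hlt) hj.target_mem hS' rfl
      exact ⟨Q'', hj.trans hj', h⟩
    · refine ⟨Q, JoinedIn.refl hQ, hS, ?_⟩
      have hA1 : ((Qᵀ * Q₁)ᵀ * (Qᵀ * Q₁)) k k = 1 := by
        rw [orthogonal_transpose_mul hQ.1 hQ₁.1, one_apply_eq]
      simp only [mul_apply (M := (Qᵀ * Q₁)ᵀ), transpose_apply] at hA1
      obtain ⟨j, hj⟩ : ∃ j, (Qᵀ * Q₁) j k ≠ 0 := by
        by_contra! h
        simp [h] at hA1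
      have hr : ∀ r, r ≠ j → (Qᵀ * Q₁) r k = 0 := fun r hr ↦ by
        by_contra h
        exact h1 (Finset.one_lt_card.2 ⟨r, by simpa using h, j, by simpa using hj, hr⟩)
      refine ⟨j, hr, mul_self_eq_one_iff.1 ?_⟩
      rwa [Finset.sum_eq_single j (fun r _ h ↦ by rw [hr r h, zero_mul]) (by simp)] at hA1

theorem exists_joinedIn_matchedOn_insert (hB : Bᵀ = B) {Q₀ Q₁ : Matrix n n ℝ}
    (hturn : ∀ i j, i ≠ j →
      JoinedIn (isotropicBases B) Q₀ (Q₀ * planeRotation i j (Real.pi / 2)))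
    (hQ₁ : Q₁ ∈ isotropicBases B) {S : Finset n} {k i : n} (hk : k ∉ S) (hi : i ∉ S) (hik : i ≠ k)
    {Q : Matrix n n ℝ} (hQ : JoinedIn (isotropicBases B) Q₀ Q) (hS : MatchedOn S (Qᵀ * Q₁)) :
    ∃ Q', JoinedIn (isotropicBases B) Q₀ Q' ∧ MatchedOn (insert k S) (Q'ᵀ * Q₁) := by
  have hmove : ∀ {Q}, JoinedIn (isotropicBases B) Q₀ Q → ∀ {i j}, i ≠ j →
      JoinedIn (isotropicBases B) Q₀ (Q * planeRotation i j (Real.pi / 2)) := fun hQ _ _ hij ↦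
    (hturn _ _ hij).trans (joinedIn_mul_quarterTurn hQ hij)
  have hmS : ∀ {Q}, MatchedOn S (Qᵀ * Q₁) → ∀ {i j}, i ≠ j → i ∉ S → j ∉ S →
      MatchedOn S ((Q * planeRotation i j (Real.pi / 2))ᵀ * Q₁) := by
    intro Q hS i j hij hi hj
    rw [transpose_mul, Matrix.mul_assoc]
    refine hS.transpose_blockExtend_mul (injective_pair hij) (fun p ↦ ?_) _
    fin_cases p
    exacts [hi, hj]
  have hins : ∀ {Q}, MatchedOn S (Qᵀ * Q₁) → (∀ r, r ≠ k → (Qᵀ * Q₁) r k = 0) →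
      (Qᵀ * Q₁) k k = 1 → MatchedOn (insert k S) (Qᵀ * Q₁) := by
    intro Q hS h0 h1 l hl r
    rcases Finset.mem_insert.1 hl with rfl | hl
    · by_cases hr : r = l
      · rw [hr, h1, one_apply_eq]
      · rw [h0 r hr, one_apply_ne hr]
    · exact hS l hl r
  -- If the target vector is `± q j` with `j ≠ k`, a quarter turn moves it to position `k`; the
  -- sense of rotation takes care of the sign.
  have key : ∀ {Q j}, JoinedIn (isotropicBases B) Q₀ Q → MatchedOn S (Qᵀ * Q₁) → j ∉ S → j ≠ k →
      (∀ r, r ≠ j → (Qᵀ * Q₁) r k = 0) → ((Qᵀ * Q₁) j k = 1 ∨ (Qᵀ * Q₁) j k = -1) →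
      ∃ Q', JoinedIn (isotropicBases B) Q₀ Q' ∧ MatchedOn (insert k S) (Q'ᵀ * Q₁) := by
    intro Q j hQ hS hj hjk h0 h1
    rcases h1 with h1 | h1
    · refine ⟨_, hmove hQ hjk.symm, hins (hmS hS hjk.symm hk hj) (fun r hr ↦ ?_) ?_⟩
      · rw [transpose_mul, Matrix.mul_assoc]
        by_cases hrj : r = j
        · rw [hrj, transpose_planeRotation_mul_right hjk.symm, h0 k hjk.symm]
          simp
        · rw [transpose_planeRotation_mul_of_ne hr hrj, h0 r hrj]
      · rw [transpose_mul, Matrix.mul_assoc, transpose_planeRotation_mul_left hjk.symm, h1]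
        simp
    · refine ⟨_, hmove hQ hjk, hins (hmS hS hjk hj hk) (fun r hr ↦ ?_) ?_⟩
      · rw [transpose_mul, Matrix.mul_assoc]
        by_cases hrj : r = j
        · rw [hrj, transpose_planeRotation_mul_left hjk, h0 k hjk.symm]
          simp
        · rw [transpose_planeRotation_mul_of_ne hrj hr, h0 r hrj]
      · rw [transpose_mul, Matrix.mul_assoc, transpose_planeRotation_mul_right hjk, h1]
        simp
  obtain ⟨Q', hQ', hS', j, h0, h1⟩ := exists_joinedIn_single hB hQ₁ hk hQ.target_mem hS
  replace hQ' := hQ.trans hQ'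
  have hA1 := orthogonal_transpose_mul hQ'.target_mem.1 hQ₁.1
  have hj : j ∉ S := fun hj ↦ by
    have := hS'.apply_eq_zero hA1 hj (k := k) (by rintro rfl; exact hk hj)
    rw [this] at h1
    norm_num at h1
  by_cases hjk : j = k
  · subst hjk
    rcases h1 with h1 | h1
    · exact ⟨Q', hQ', hins hS' h0 h1⟩
    · refine key (j := i) (hmove hQ' hik.symm) (hmS hS' hik.symm hk hi) hi hik (fun r hr ↦ ?_)
        (Or.inl ?_)
      · rw [transpose_mul, Matrix.mul_assoc]
        by_cases hrj : r = j
        · rw [hrj, transpose_planeRotation_mul_left hik.symm, h0 i hik]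
          simp
        · rw [transpose_planeRotation_mul_of_ne hrj hr, h0 r hrj]
      · rw [transpose_mul, Matrix.mul_assoc, transpose_planeRotation_mul_right hik.symm, h1]
        simp
  · exact key hQ' hS' hj hjk h0 h1

/-- If `Q₀` can be joined to all of its quarter turns, then it can be joined to every isotropic basis of
the same orientation: match the basis vectors one at a time, the orientation taking care of the
last one. -/
theorem joinedIn_of_det_eq [Nonempty n] (hB : Bᵀ = B) {Q₀ Q₁ : Matrix n n ℝ}
    (hturn : ∀ i j, i ≠ j →
      JoinedIn (isotropicBases B) Q₀ (Q₀ * planeRotation i j (Real.pi / 2)))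
    (hQ₀ : Q₀ ∈ isotropicBases B) (hQ₁ : Q₁ ∈ isotropicBases B) (hdet : Q₀.det = Q₁.det) :
    JoinedIn (isotropicBases B) Q₀ Q₁ := by
  have hmatch : ∀ S : Finset n, S ≠ Finset.univ →
      ∃ Q, JoinedIn (isotropicBases B) Q₀ Q ∧ MatchedOn S (Qᵀ * Q₁) := by
    intro S
    induction S using Finset.induction_on with
    | empty => exact fun _ ↦ ⟨Q₀, JoinedIn.refl hQ₀, fun l hl ↦ by simp at hl⟩
    | insert k S hk ih =>
      intro hne
      obtain ⟨i, hi⟩ : ∃ i, i ∉ insert k S := by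
        by_contra! h
        exact hne (Finset.eq_univ_iff_forall.2 h)
      rw [Finset.mem_insert, not_or] at hi
      obtain ⟨Q, hQ, hS⟩ := ih (by rintro rfl; exact hk (Finset.mem_univ _))
      exact exists_joinedIn_matchedOn_insert hB hturn hQ₁ hk hi.2 hi.1 hQ hS
  obtain ⟨k⟩ := ‹Nonempty n›
  obtain ⟨Q, hQ, hS⟩ := hmatch (Finset.univ.erase k) (by
    intro h
    have hk := Finset.mem_univ k
    rw [← h] at hk
    simp at hk)
  have hA1 := orthogonal_transpose_mul hQ.target_mem.1 hQ₁.1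
  have hdiag : Qᵀ * Q₁ = diagonal fun i ↦ if i = k then (Qᵀ * Q₁) k k else 1 := by
    ext r l
    by_cases hl : l = k
    · subst hl
      by_cases hr : r = l
      · simp [hr]
      · rw [hS.apply_eq_zero hA1 (by simpa using hr) (Ne.symm hr), diagonal_apply_ne _ hr]
    · rw [hS l (by simpa using hl)]
      by_cases hr : r = l
      · rw [hr]; simp [hl]
      · rw [one_apply_ne hr, diagonal_apply_ne _ hr]
  have hdetA : (Qᵀ * Q₁).det = 1 := by
    rw [det_mul, det_transpose, ← det_eq_of_joinedIn hQ, hdet,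
      det_mul_self_of_transpose_mul_self hQ₁.1]
  have hkk : (Qᵀ * Q₁) k k = 1 := by
    rw [hdiag, det_diagonal] at hdetA
    simpa using hdetA
  have hone : Qᵀ * Q₁ = 1 := by
    rw [hdiag, hkk]; simp
  have : Q = Q₁ := by
    rw [← Matrix.mul_one Q, ← hone, ← Matrix.mul_assoc, mul_eq_one_comm.1 hQ.target_mem.1,
      Matrix.one_mul]
  exact this ▸ hQ

end Matching

/-! ### Existence of isotropic bases -/

section Existence

variable {n : Type*} [Fintype n] [DecidableEq n] {B : Matrix n n ℝ}

/-- For a traceless form, every orthonormal basis can be changed into an isotropic one without changing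
the vectors that are isotropic already: rotate a vector on which the form is positive towards one on
which it is negative. -/
theorem exists_isotropicBases_of_trace_eq_zero (htr : B.trace = 0) {Q : Matrix n n ℝ}
    (hQ : Qᵀ * Q = 1) : ∃ Q' ∈ isotropicBases B,
      ∀ k, (Qᵀ * B * Q) k k = 0 → ∀ r, Q' r k = Q r k := by
  induction hc : (Finset.univ.filter fun k ↦ (Qᵀ * B * Q) k k ≠ 0).card using
    Nat.strong_induction_on generalizing Q with
  | _ c ih =>
    by_cases h0 : ∀ k, (Qᵀ * B * Q) k k = 0
    · exact ⟨Q, ⟨hQ, h0⟩, fun _ _ _ ↦ rfl⟩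
    push Not at h0
    set M := Qᵀ * B * Q with hM
    have hsum : ∑ k, M k k = 0 := by
      change M.trace = 0
      rw [hM, trace_mul_cycle, mul_eq_one_comm.1 hQ, Matrix.one_mul, htr]
    obtain ⟨k, hk⟩ := h0
    obtain ⟨i, -, hi⟩ : ∃ i ∈ Finset.univ, 0 < M i i :=
      Finset.exists_pos_of_sum_zero_of_exists_nonzero _ hsum ⟨k, Finset.mem_univ k, hk⟩
    obtain ⟨j, -, hj⟩ : ∃ j ∈ Finset.univ, 0 < -M j j :=
      Finset.exists_pos_of_sum_zero_of_exists_nonzero _ (by simpa using hsum)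
        ⟨k, Finset.mem_univ k, neg_ne_zero.2 hk⟩
    have hij : i ≠ j := by rintro rfl; linarith
    have hcont : Continuous fun t : ℝ ↦ Real.cos t * (Real.cos t * M i i + Real.sin t * M j i) +
      Real.sin t * (Real.cos t * M i j + Real.sin t * M j j) := by fun_prop
    obtain ⟨t, ht⟩ := mem_range_of_exists_le_of_exists_ge (c := 0) hcont
      ⟨Real.pi / 2, by simpa using hj.le⟩ ⟨0, by simpa using hi.le⟩
    have hne : ∀ l, M l l = 0 → l ≠ i ∧ l ≠ j := fun l hl ↦
      ⟨by rintro rfl; linarith, by rintro rfl; linarith⟩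
    have hM' : ∀ l, M l l = 0 →
        ((Q * planeRotation i j t)ᵀ * B * (Q * planeRotation i j t)) l l = 0 := fun l hl ↦ by
      rw [transpose_mul_mul_mul, mul_planeRotation_of_ne (hne l hl).1 (hne l hl).2,
        transpose_planeRotation_mul_of_ne (hne l hl).1 (hne l hl).2, ← hM, hl]
    have hMi : ((Q * planeRotation i j t)ᵀ * B * (Q * planeRotation i j t)) i i = 0 := by
      rw [transpose_mul_mul_mul, mul_planeRotation_left hij, transpose_planeRotation_mul_left hij,
        transpose_planeRotation_mul_left hij]
      exact ht
    obtain ⟨Q', hQ', h'⟩ := ih _ (hc ▸ Finset.card_lt_card (Finset.ssubset_iff_of_subset (by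
        intro l
        simp only [Finset.mem_filter, Finset.mem_univ, true_and]
        exact mt (hM' l)) |>.2 ⟨i, by simpa using hi.ne', by simpa using hMi⟩))
      (Q := Q * planeRotation i j t) (orthogonal_mul hQ (planeRotation_orthogonal hij t)) rfl
    refine ⟨Q', hQ', fun l hl r ↦ ?_⟩
    rw [h' l (hM' l hl), mul_planeRotation_of_ne (hne l hl).1 (hne l hl).2]

theorem transpose_mul_diagonal_mul_apply (w : n → ℝ) (Q : Matrix n n ℝ) (a b : n) :
    (Qᵀ * diagonal w * Q) a b = ∑ r, w r * (Q r a * Q r b) := by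
  rw [mul_apply]
  simp only [mul_diagonal, transpose_apply]
  exact Finset.sum_congr rfl fun r _ ↦ by ring

end Existence

/-! ### Unit norm tight frames as isotropic bases -/

section Frames

variable {d e : ℕ}

/-- The quadratic form `P - d / (d + e)` on `ℝ^(d + e)`, where `P` is the projection to the first
`d` coordinates: the diagonal matrix with `d` entries `1 - d / (d + e)` followed by `e` entries
`- d / (d + e)`. -/
noncomputable def frameForm (d e : ℕ) : Matrix (Fin (d + e)) (Fin (d + e)) ℝ :=
  diagonal (Fin.append (fun _ : Fin d ↦ 1 - (d / (d + e) : ℝ)) fun _ : Fin e ↦ -(d / (d + e) : ℝ))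

theorem frameForm_transpose : (frameForm d e)ᵀ = frameForm d e := diagonal_transpose _

theorem trace_frameForm (hd : 0 < d) : (frameForm d e).trace = 0 := by
  have : (d : ℝ) + e ≠ 0 := by positivity
  simp [frameForm, trace, Fin.sum_univ_add]
  field_simp
  ring

/-- The columns of `Q`, projected to the first `d` coordinates and rescaled by `√((d + e) / d)`. -/
noncomputable def toFrame (d e : ℕ) (Q : Matrix (Fin (d + e)) (Fin (d + e)) ℝ) :
    Fin (d + e) → EuclideanSpace ℝ (Fin d) :=
  fun k ↦ WithLp.toLp 2 fun i ↦ √((d + e) / d) * Q (Fin.castAdd e i) k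

theorem continuous_toFrame : Continuous (toFrame d e) := by
  unfold toFrame
  fun_prop

/-- A column of an orthogonal matrix is isotropic for `frameForm` if and only if its first `d`
coordinates carry the proportion `d / (d + e)` of its squared norm. -/
theorem gram_frameForm_apply {Q : Matrix (Fin (d + e)) (Fin (d + e)) ℝ} (hQ : Qᵀ * Q = 1)
    (k : Fin (d + e)) : (Qᵀ * frameForm d e * Q) k k =
      ∑ i : Fin d, Q (Fin.castAdd e i) k ^ 2 - d / (d + e) := by
  have h1 : (Qᵀ * Q) k k = 1 := by rw [hQ, one_apply_eq]
  rw [mul_apply, Fin.sum_univ_add] at h1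
  simp only [transpose_apply] at h1
  rw [frameForm, transpose_mul_diagonal_mul_apply, Fin.sum_univ_add]
  simp only [Fin.append_left, Fin.append_right, ← Finset.mul_sum, ← sq] at h1 ⊢
  linear_combination (-(d / (d + e) : ℝ)) * h1

theorem toFrame_mem (hd : 0 < d) {Q : Matrix (Fin (d + e)) (Fin (d + e)) ℝ}
    (hQ : Q ∈ isotropicBases (frameForm d e)) : toFrame d e Q ∈ realFUNTF (d + e) d := by
  have hd' : (0 : ℝ) < d := by exact_mod_cast hd
  have hs : √((d + e : ℝ) / d) ^ 2 = (d + e) / d := Real.sq_sqrt (by positivity)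
  refine ⟨fun k ↦ ?_, (d + e) / d, by positivity, fun x ↦ ?_⟩
  · have h := hQ.2 k
    rw [gram_frameForm_apply hQ.1, sub_eq_zero] at h
    rw [← sq_eq_sq₀ (norm_nonneg _) zero_le_one, EuclideanSpace.real_norm_sq_eq]
    simp only [toFrame, mul_pow, hs, ← Finset.mul_sum, h]
    field_simp
  · set P := Q.submatrix (Fin.castAdd e) id with hP
    have hPP : P * Pᵀ = 1 := by
      have h1 : P * Pᵀ = (Q * Qᵀ).submatrix (Fin.castAdd e) (Fin.castAdd e) := by
        ext i j; simp [hP, mul_apply]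
      rw [h1, mul_eq_one_comm.1 hQ.1]
      ext i j
      simp [one_apply]
    have h2 : ∀ k, |inner ℝ x (toFrame d e Q k)| ^ 2 =
        (d + e) / d * ((x.ofLp ᵥ* P) k * (x.ofLp ᵥ* P) k) := fun k ↦ by
      have : inner ℝ x (toFrame d e Q k) = √((d + e) / d) * (x.ofLp ᵥ* P) k := by
        simp only [toFrame, PiLp.inner_apply, vecMul, dotProduct, hP, submatrix_apply, id,
          RCLike.inner_apply, conj_trivial, Finset.mul_sum]
        exact Finset.sum_congr rfl fun i _ ↦ by ring
      rw [sq_abs, ← hs, this]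
      ring
    rw [Finset.sum_congr rfl fun k _ ↦ h2 k, ← Finset.mul_sum, EuclideanSpace.real_norm_sq_eq]
    congr 1
    change (x.ofLp ᵥ* P) ⬝ᵥ (x.ofLp ᵥ* P) = _
    rw [← dotProduct_mulVec, ← mulVec_transpose, mulVec_mulVec, hPP, one_mulVec]
    simp [dotProduct, sq]

theorem sum_apply_mul_apply_of_tight {N : ℕ} {f : Fin N → EuclideanSpace ℝ (Fin d)} {A : ℝ}
    (hf : ∀ x : EuclideanSpace ℝ (Fin d), ∑ n, |inner ℝ x (f n)| ^ 2 = A * ‖x‖ ^ 2) (i j : Fin d) :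
    ∑ n, f n i * f n j = if i = j then A else 0 := by
  have h1 : ∀ i, ∑ n, f n i * f n i = A := fun i ↦ by
    have := hf (EuclideanSpace.single i 1)
    simpa [EuclideanSpace.inner_single_left, sq] using this
  by_cases hij : i = j
  · rw [hij, h1, if_pos rfl]
  · have h2 := hf (EuclideanSpace.single i 1 + EuclideanSpace.single j 1)
    have h3 : ‖(EuclideanSpace.single i 1 + EuclideanSpace.single j 1 :
        EuclideanSpace ℝ (Fin d))‖ ^ 2 = 2 := by
      rw [norm_add_sq_real]
      simp [EuclideanSpace.inner_single_left, hij]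
      norm_num
    rw [h3] at h2
    simp only [inner_add_left, EuclideanSpace.inner_single_left, map_one, one_mul, sq_abs, add_sq,
      Finset.sum_add_distrib, mul_assoc, ← Finset.mul_sum] at h2
    have hi := h1 i
    have hj := h1 j
    simp only [← sq] at hi hj
    rw [if_neg hij]
    linarith

theorem frameBound_eq {N : ℕ} (hd : 0 < d) {f : Fin N → EuclideanSpace ℝ (Fin d)} {A : ℝ}
    (h1 : ∀ n, ‖f n‖ = 1)
    (hf : ∀ x : EuclideanSpace ℝ (Fin d), ∑ n, |inner ℝ x (f n)| ^ 2 = A * ‖x‖ ^ 2) :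
    A = N / d := by
  have hd' : (0 : ℝ) < d := by exact_mod_cast hd
  have h2 : ∑ n, ∑ i, f n i * f n i = N := by
    have : ∀ n, ∑ i, f n i * f n i = 1 := fun n ↦ by
      simp only [← sq, ← EuclideanSpace.real_norm_sq_eq, h1, one_pow]
    simp [this]
  rw [Finset.sum_comm] at h2
  simp only [sum_apply_mul_apply_of_tight hf, if_true] at h2
  simp at h2
  field_simp
  linarith

/-- Every unit norm tight frame is obtained from an isotropic basis of either orientation. -/
theorem exists_toFrame_eq (hd : 0 < d) (he : 0 < e)
    {f : Fin (d + e) → EuclideanSpace ℝ (Fin d)} (hf : f ∈ realFUNTF (d + e) d) {σ : ℝ}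
    (hσ : σ * σ = 1) :
    ∃ Q ∈ isotropicBases (frameForm d e), toFrame d e Q = f ∧ Q.det = σ := by
  obtain ⟨h1, A, hA, hfA⟩ := hf
  have hAd := frameBound_eq hd h1 hfA
  push_cast at hAd
  have hd' : (0 : ℝ) < d := by exact_mod_cast hd
  have hs : √((d + e : ℝ) / d) * √((d + e : ℝ) / d) = A := by
    rw [hAd]; exact Real.mul_self_sqrt (by positivity)
  have hs0 : √((d + e : ℝ) / d) ≠ 0 := by
    intro h; rw [h] at hs; simp at hs; exact hA.ne hs
  set s := √((d + e : ℝ) / d) with hs_def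
  -- The rescaled rows of `f` are orthonormal; they are completed to an orthonormal basis.
  set v : Fin (d + e) → EuclideanSpace ℝ (Fin (d + e)) :=
    Fin.append (fun i : Fin d ↦ WithLp.toLp 2 fun n ↦ s⁻¹ * f n i) fun _ : Fin e ↦ 0 with hv
  have hvo : Orthonormal ℝ ((Set.range (Fin.castAdd (n := d) e)).domRestrict v) := by
    rw [orthonormal_iff_ite]
    rintro ⟨_, i, rfl⟩ ⟨_, j, rfl⟩
    have h := sum_apply_mul_apply_of_tight hfA i j
    change inner ℝ (v (Fin.castAdd e i)) (v (Fin.castAdd e j)) = _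
    have h2 : inner ℝ (v (Fin.castAdd e i)) (v (Fin.castAdd e j)) =
        (s * s)⁻¹ * ∑ n, f n i * f n j := by
      simp only [hv, Fin.append_left, PiLp.inner_apply, RCLike.inner_apply, conj_trivial,
        Finset.mul_sum]
      exact Finset.sum_congr rfl fun n _ ↦ by rw [mul_inv]; ring
    rw [h2, h, hs]
    by_cases hij : i = j
    · subst hij
      rw [if_pos rfl, if_pos rfl, inv_mul_cancel₀ hA.ne']
    · rw [if_neg hij, if_neg (by simpa [Subtype.ext_iff] using hij), mul_zero]
  obtain ⟨b, hb⟩ := hvo.exists_orthonormalBasis_extension_of_card_eq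
    (by simp)
  set Q : Matrix (Fin (d + e)) (Fin (d + e)) ℝ := Matrix.of fun r n ↦ b r n with hQ_def
  have hQ1 : Qᵀ * Q = 1 := by
    rw [mul_eq_one_comm]
    ext r r'
    have := orthonormal_iff_ite.1 b.orthonormal r' r
    simp only [PiLp.inner_apply, RCLike.inner_apply, conj_trivial] at this
    simp only [mul_apply, transpose_apply, hQ_def, of_apply, this, one_apply, eq_comm]
  have hQf : ∀ i n, Q (Fin.castAdd e i) n = s⁻¹ * f n i := fun i n ↦ by
    rw [hQ_def, of_apply, hb _ ⟨i, rfl⟩, hv, Fin.append_left]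
  have hmem : ∀ {Q' : Matrix (Fin (d + e)) (Fin (d + e)) ℝ}, Q'ᵀ * Q' = 1 →
      (∀ i n, Q' (Fin.castAdd e i) n = s⁻¹ * f n i) →
      Q' ∈ isotropicBases (frameForm d e) ∧ toFrame d e Q' = f := by
    intro Q' hQ' h
    refine ⟨⟨hQ', fun k ↦ ?_⟩, ?_⟩
    · rw [gram_frameForm_apply hQ', sub_eq_zero]
      simp only [h, mul_pow, ← Finset.mul_sum, ← EuclideanSpace.real_norm_sq_eq, h1]
      rw [inv_pow, sq, hs, hAd]
      simp
    · ext k i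
      simp only [toFrame, h, ← hs_def]
      rw [mul_inv_cancel_left₀ hs0]
  by_cases hdet : Q.det = σ
  · exact ⟨Q, (hmem hQ1 hQf).1, (hmem hQ1 hQf).2, hdet⟩
  · -- Negating a row that does not contribute to the frame changes the sign of the determinant.
    set D : Matrix (Fin (d + e)) (Fin (d + e)) ℝ :=
      diagonal (Function.update 1 (Fin.natAdd d ⟨0, he⟩) (-1)) with hD
    have hDD : Dᵀ * D = 1 := by
      rw [hD, diagonal_transpose, diagonal_mul_diagonal, ← diagonal_one]
      congr 1
      ext r
      by_cases hr : r = Fin.natAdd d ⟨0, he⟩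
      · subst hr; simp
      · rw [Function.update_of_ne hr]; simp
    have hDQ1 : (D * Q)ᵀ * (D * Q) = 1 := orthogonal_mul hDD hQ1
    have hDQf : ∀ i n, (D * Q) (Fin.castAdd e i) n = s⁻¹ * f n i := fun i n ↦ by
      have : Fin.castAdd e i ≠ Fin.natAdd d ⟨0, he⟩ := by
        intro h
        have := congrArg Fin.val h
        simp at this
        omega
      rw [hD, diagonal_mul, Function.update_of_ne this, hQf]
      simp
    have hDdet : D.det = -1 := by
      rw [hD, det_diagonal, Finset.prod_update_of_mem (Finset.mem_univ _)]
      simp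
    refine ⟨D * Q, (hmem hDQ1 hDQf).1, (hmem hDQ1 hDQf).2, ?_⟩
    rw [det_mul, hDdet]
    have := det_mul_self_of_transpose_mul_self hQ1
    have h3 : (Q.det - σ) * (Q.det + σ) = 0 := by linear_combination this - hσ
    rcases mul_eq_zero.1 h3 with h | h
    · exact absurd (sub_eq_zero.1 h) hdet
    · linarith

/-- There is an isotropic basis with two vectors that are orthogonal for the form; this corresponds
to a unit norm tight frame with two orthogonal vectors. -/
theorem exists_isotropicBases_gram_eq_zero (hd : 2 ≤ d) (he : 2 ≤ e) :
    ∃ Q ∈ isotropicBases (frameForm d e), ∃ a b, a ≠ b ∧ (Qᵀ * frameForm d e * Q) a b = 0 := by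
  have hd' : (0 : ℝ) < d := by exact_mod_cast (by omega : 0 < d)
  have hδ0 : (0 : ℝ) ≤ d / (d + e) := by positivity
  have hδ1 : (d / (d + e) : ℝ) ≤ 1 := (div_le_one (by positivity)).2 (by simp)
  obtain ⟨t, ht⟩ : ∃ t : ℝ, Real.cos t ^ 2 = d / (d + e) :=
    ⟨Real.arccos √(d / (d + e)), by
      rw [Real.cos_arccos (by linarith [Real.sqrt_nonneg (d / (d + e) : ℝ)])
        (Real.sqrt_le_one.2 hδ1), Real.sq_sqrt hδ0]⟩
  have ht' : Real.sin t ^ 2 = 1 - d / (d + e) := by rw [Real.sin_sq, ht]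
  obtain ⟨a, ha⟩ : ∃ a : Fin (d + e), a = Fin.castAdd e ⟨0, by omega⟩ := ⟨_, rfl⟩
  obtain ⟨b, hb⟩ : ∃ b : Fin (d + e), b = Fin.castAdd e ⟨1, by omega⟩ := ⟨_, rfl⟩
  obtain ⟨a', ha'⟩ : ∃ a : Fin (d + e), a = Fin.natAdd d ⟨0, by omega⟩ := ⟨_, rfl⟩
  obtain ⟨b', hb'⟩ : ∃ b : Fin (d + e), b = Fin.natAdd d ⟨1, by omega⟩ := ⟨_, rfl⟩
  have hab : a ≠ b := by simp [ha, hb, Fin.ext_iff]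
  have haa' : a ≠ a' := by simp [ha, ha', Fin.ext_iff]; omega
  have hab' : a ≠ b' := by simp [ha, hb', Fin.ext_iff]
  have hba' : b ≠ a' := by simp [hb, ha', Fin.ext_iff]; omega
  have hbb' : b ≠ b' := by simp [hb, hb', Fin.ext_iff]; omega
  have ha'b' : a' ≠ b' := by simp [ha', hb', Fin.ext_iff]
  set Q : Matrix (Fin (d + e)) (Fin (d + e)) ℝ :=
    1 * planeRotation a a' t * planeRotation b b' t with hQ_def
  have hQ : Qᵀ * Q = 1 := by
    rw [hQ_def, Matrix.one_mul]
    exact orthogonal_mul (planeRotation_orthogonal haa' t) (planeRotation_orthogonal hbb' t)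
  have hQa : ∀ r, Q r a = Real.cos t * (1 : Matrix _ _ ℝ) r a + Real.sin t *
      (1 : Matrix _ _ ℝ) r a' := fun r ↦ by
    rw [hQ_def, mul_planeRotation_of_ne hab hab', mul_planeRotation_left haa']
  have hQb : ∀ r, Q r b = Real.cos t * (1 : Matrix _ _ ℝ) r b + Real.sin t *
      (1 : Matrix _ _ ℝ) r b' := fun r ↦ by
    rw [hQ_def, mul_planeRotation_left hbb', mul_planeRotation_of_ne hab.symm hba',
      mul_planeRotation_of_ne hab'.symm ha'b'.symm]
  have hgram : ∀ Q : Matrix (Fin (d + e)) (Fin (d + e)) ℝ, ∀ k l, (Qᵀ * frameForm d e * Q) k l =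
      ∑ r, (Fin.append (fun _ : Fin d ↦ 1 - (d / (d + e) : ℝ))
        fun _ : Fin e ↦ -(d / (d + e) : ℝ)) r * (Q r k * Q r l) := fun Q k l ↦
    transpose_mul_diagonal_mul_apply _ _ _ _
  have hdiag : ∀ k k' : Fin (d + e), k ≠ k' → (∀ r, Q r k = Real.cos t * (1 : Matrix _ _ ℝ) r k +
      Real.sin t * (1 : Matrix _ _ ℝ) r k') → (Qᵀ * frameForm d e * Q) k k =
        Real.cos t ^ 2 * frameForm d e k k + Real.sin t ^ 2 * frameForm d e k' k' := by
    intro k k' hkk' h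
    have h1 : ∀ r, (Q r k * Q r k) = Real.cos t ^ 2 * (1 : Matrix _ _ ℝ) r k +
        Real.sin t ^ 2 * (1 : Matrix _ _ ℝ) r k' := fun r ↦ by
      rw [h, one_apply, one_apply]
      split_ifs with h1 h2
      · exact absurd (h1.symm.trans h2) hkk'
      all_goals ring
    rw [hgram]
    simp only [h1, mul_add, Finset.sum_add_distrib, frameForm, diagonal_apply_eq, one_apply]
    simp
    ring
  have hMa : (Qᵀ * frameForm d e * Q) a a = 0 := by
    rw [hdiag a a' haa' hQa, ht, ht', ha, ha']
    simp only [frameForm, diagonal_apply_eq, Fin.append_left, Fin.append_right]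
    ring
  have hMb : (Qᵀ * frameForm d e * Q) b b = 0 := by
    rw [hdiag b b' hbb' hQb, ht, ht', hb, hb']
    simp only [frameForm, diagonal_apply_eq, Fin.append_left, Fin.append_right]
    ring
  have hMab : (Qᵀ * frameForm d e * Q) a b = 0 := by
    rw [hgram]
    refine Finset.sum_eq_zero fun r _ ↦ mul_eq_zero_of_right _ ?_
    rw [hQa, hQb]
    simp only [one_apply]
    split_ifs <;> simp_all
  obtain ⟨Q', hQ', h⟩ := exists_isotropicBases_of_trace_eq_zero (trace_frameForm (by omega)) hQ
  refine ⟨Q', hQ', a, b, hab, ?_⟩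
  rw [hgram] at hMab ⊢
  simp only [h a hMa, h b hMb, hMab]

end Frames

theorem theorem1p2 (N d : ℕ) (hd : 4 ≤ d + 2) (hN : d + 2 ≤ N) :
    IsPathConnected (realFUNTF N d) := by
  obtain ⟨e, rfl⟩ := Nat.exists_eq_add_of_le (show d ≤ N by omega)
  obtain ⟨Q₀, hQ₀, a, b, hab, h₀⟩ :=
    exists_isotropicBases_gram_eq_zero (d := d) (e := e) (by omega) (by omega)
  refine ⟨_, toFrame_mem (by omega) hQ₀, fun {f} hf ↦ ?_⟩
  obtain ⟨Q₁, hQ₁, rfl, hdet⟩ := exists_toFrame_eq (by omega) (by omega) hf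
    (det_mul_self_of_transpose_mul_self hQ₀.1)
  have : Nonempty (Fin (d + e)) := ⟨a⟩
  have hj := joinedIn_of_det_eq frameForm_transpose
    (fun i j hij ↦ joinedIn_quarterTurn_of_gram_eq_zero frameForm_transpose hQ₀ hab h₀ hij)
    hQ₀ hQ₁ hdet.symm
  refine (hj.map_continuousOn continuous_toFrame.continuousOn).mono ?_
  rintro _ ⟨Q, hQ, rfl⟩
  exact toFrame_mem (by omega) hQ
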